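/- Let $S=\{(1,0),(-1,0),(0,1),(0,-1)\}$. A sequence of instructions is an infinite nearest-neighbour walk $x=(x_t)_{t\ge 0}$ in $\mathbb{Z}^2$, i.e. $x_0=0$ and $x_{t+1}-x_t\in S$ for all $t\ge 0$. For $p\in[0,1]$, the guided random walk with instructions $x$ and error probability $p$ is the Markov chain $(X_t)_{t\ge 0}$ in $\mathbb{Z}^2$ with $X_0=0$ in which, independently of the past, $X_{t+1}-X_t$ equals $x_{t+1}-x_t$ with probability $1-p$ and is uniformly distributed on $S$ with probability $p$. For $x_{\mathrm{home}}\in\mathbb{Z}^2$ let $T:=\inf\{t\ge 0 : X_t=x_{\mathrm{home}}\}\in\{0,1,2,\dots\}\cup\{\infty\}$. For a positive integer $\tau$ let $$R_\tau(p):=\min_{x}\ \mathbb{E}\bigl[\#\{t\in\{0,1,\dots,\tau\} : X_t=0\}\bigr],$$ where the minimum is over all sequences of instructions $x$ (time $0$ is counted, so $R_\tau(p)\ge 1$). Proposition. Let $0<p\le 1$ and $x_{\mathrm{home}}\in\mathbb{Z}^2\setminus\{0\}$, and suppose that there is a sequence of instructions such that $\mathbb{E}[T]<\infty$. Then, for every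 positive integer $\tau$, $$1\le \frac{4}{\pi\, p\,\sqrt{3-2p}\;R_\tau(p)}.$$ -/

import Mathlib

open MeasureTheory
open scoped ENNReal

noncomputable section

namespace GuidedWalk

/-- The four unit steps of the square grid. -/
def unitSteps : Finset (ℤ × ℤ) := {(1, 0), (-1, 0), (0, 1), (0, -1)}

/-- A sequence of instructions: an infinite nearest-neighbour walk in `ℤ²` started at `0`. -/
structure Instructions where
  /-- the position prescribed at each time -/
  pos : ℕ → ℤ × ℤ
  pos_zero : pos 0 = 0
  step_mem : ∀ t, pos (t + 1) - pos t ∈ unitSteps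

/-- The instructed increment between times `t` and `t + 1`. -/
def Instructions.step (x : Instructions) (t : ℕ) : ℤ × ℤ := x.pos (t + 1) - x.pos t

/-- The law of one increment of the walk when the instructed increment is `v`: equal to `v` with
probability `1 - p`, and uniform on the four unit steps with probability `p`. -/
def stepLaw (p : unitInterval) (v : ℤ × ℤ) : Measure (ℤ × ℤ) :=
  ENNReal.ofReal (1 - p) • Measure.dirac v +
    ∑ u ∈ unitSteps, ENNReal.ofReal (p / 4) • Measure.dirac u

instance stepLaw_isProbabilityMeasure (p : unitInterval) (v : ℤ × ℤ) :
    IsProbabilityMeasure (stepLaw p v) := by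
  constructor
  have h0 : (0 : ℝ) ≤ (p : ℝ) / 4 := div_nonneg p.2.1 (by norm_num)
  have h1 : (0 : ℝ) ≤ 1 - (p : ℝ) := sub_nonneg.2 p.2.2
  have hc : unitSteps.card = 4 := by decide
  simp only [stepLaw, Measure.coe_add, Measure.coe_smul, Measure.coe_finsetSum, Pi.add_apply,
    Pi.smul_apply, Finset.sum_apply, measure_univ, smul_eq_mul, mul_one, Finset.sum_const, hc]
  rw [← ENNReal.ofReal_nsmul, ← ENNReal.ofReal_add h1 (by positivity), ← ENNReal.ofReal_one]
  congr 1
  simp only [nsmul_eq_mul]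
  push_cast
  ring

/-- The joint law of the increments of the guided random walk: the increments are independent
(the increment at time `t` has law `stepLaw p (x.step t)` whatever the past), so this is the
product measure on the space of increment sequences. -/
def law (p : unitInterval) (x : Instructions) : Measure (ℕ → ℤ × ℤ) :=
  Measure.infinitePi fun t => stepLaw p (x.step t)

/-- The position `X_t` of the walk started at `0`, as a function of the increments. Under
`law p x` the process `walk` is the guided random walk with instructions `x` and error
probability `p`. -/
def walk (t : ℕ) (ω : ℕ → ℤ × ℤ) : ℤ × ℤ := ∑ i ∈ Finset.range t, ω i

/-- The hitting time `T = inf {t : X_t = home}`, equal to `∞` if `home` is never visited. -/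
def hittingTime (home : ℤ × ℤ) (ω : ℕ → ℤ × ℤ) : ℝ≥0∞ :=
  ⨅ (t : ℕ) (_ : walk t ω = home), (t : ℝ≥0∞)

/-- The expected hitting time `𝔼[T]`, possibly infinite. -/
def expectedHittingTime (p : unitInterval) (x : Instructions) (home : ℤ × ℤ) : ℝ≥0∞ :=
  ∫⁻ ω, hittingTime home ω ∂(law p x)

/-- The number of times `t ∈ {0, 1, …, τ}` (time `0` included) at which the walk is at `0`. -/
def visits (τ : ℕ) (ω : ℕ → ℤ × ℤ) : ℕ :=
  ((Finset.range (τ + 1)).filter fun t => walk t ω = 0).card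

/-- `R_τ(p)`: the least expected number of visits to the starting point during `{0, …, τ}`,
over all sequences of instructions. (The expectation depends only on the first `τ`
instructions, so the infimum is attained.) -/
def minReturns (τ : ℕ) (p : unitInterval) : ℝ :=
  ⨅ x : Instructions, ∫ ω, (visits τ ω : ℝ) ∂(law p x)

end GuidedWalk

end

/-! Compare two estimates of `S = ∑ t · P(X_t = v and v is not visited up to time t/2)` for a target
`v` with `E[T] < ∞`.

Upper bound: by a local limit estimate, uniform in the instructions and the endpoint, `n · P(X_n =
w) ≤ D` for large `n`, where `D` is any number above `heatConst p` (`exists_law_walk_bound`).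
Applying it after the time `t/2` bounds the term of index `t` by `2D · P(T > t/2)`. By parity only
one of `t = 2j`, `t = 2j + 1` contributes, so `S ≤ 2D · E[T] + const` (`tsum_avoids_inter_le`).

Lower bound: a first visit at a time `r > τ` is followed by at least `R = R_τ(p)` expected visits
during `{r, …, r + τ}`. At each of these times `t` one has `t/2 < r ≤ t`, so `S ≥ R · E[T] - Rτ`
(`mul_tsum_firstVisit_le`).

Hence `(R - 2D) · E[T]` is bounded by a constant independent of the target and the instructions. One
finite `E[T]` yields arbitrarily large finite ones: with positive probability the walk first goes
`k` steps away from home (`exists_far_home`). So `R ≤ 2 · heatConst p`, which is the claim. -/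

noncomputable section

namespace GuidedWalk

open ProbabilityTheory

/-! ### Shifted instructions and the Markov property -/

/-- The instructions that remain after the first `k` of them. -/
def Instructions.shift (x : Instructions) (k : ℕ) : Instructions where
  pos n := x.pos (n + k) - x.pos k
  pos_zero := by simp
  step_mem n := by
    have h := x.step_mem (n + k)
    rw [show n + 1 + k = n + k + 1 by ring]
    simpa using h

theorem Instructions.shift_step (x : Instructions) (k n : ℕ) :
    (x.shift k).step n = x.step (n + k) := by
  simp only [Instructions.step, Instructions.shift, show n + 1 + k = n + k + 1 by ring]
  abel

theorem Instructions.step_mem_unitSteps (x : Instructions) (n : ℕ) : x.step n ∈ unitSteps :=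
  x.step_mem n

instance law_isProbabilityMeasure (p : unitInterval) (x : Instructions) :
    IsProbabilityMeasure (law p x) := by
  unfold law; infer_instance

/-- The increment sequence from time `k` on. -/
def drop (k : ℕ) (ω : ℕ → ℤ × ℤ) : ℕ → ℤ × ℤ := fun i => ω (i + k)

theorem measurable_drop (k : ℕ) : Measurable (drop k) := by
  unfold drop; fun_prop

theorem measurable_walk (t : ℕ) : Measurable (walk t) := by
  unfold walk; fun_prop

theorem measurableSet_walk_eq (t : ℕ) (v : ℤ × ℤ) : MeasurableSet {ω | walk t ω = v} :=
  measurable_walk t (measurableSet_singleton v)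

theorem walk_add (s m : ℕ) (ω : ℕ → ℤ × ℤ) :
    walk (s + m) ω = walk s ω + walk m (drop s ω) := by
  simp only [walk, drop, Finset.sum_range_add, add_comm]

theorem walk_zero (ω : ℕ → ℤ × ℤ) : walk 0 ω = 0 := by simp [walk]

theorem map_drop_law (p : unitInterval) (x : Instructions) (k : ℕ) :
    (law p x).map (drop k) = law p (x.shift k) := by
  unfold law drop
  rw [Measure.map_infinitePi_infinitePi_of_inj (f := fun i : ℕ => i + k) (add_left_injective k)]
  simp only [Instructions.shift_step]

/-- An event which depends only on the first `k` increments. -/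
def DependsOnFirst (k : ℕ) (A : Set (ℕ → ℤ × ℤ)) : Prop :=
  ∀ ω ω' : ℕ → ℤ × ℤ, (∀ i < k, ω i = ω' i) → (ω ∈ A → ω' ∈ A)

theorem DependsOnFirst.inter {k : ℕ} {A B : Set (ℕ → ℤ × ℤ)} (hA : DependsOnFirst k A)
    (hB : DependsOnFirst k B) : DependsOnFirst k (A ∩ B) :=
  fun ω ω' h hω => ⟨hA ω ω' h hω.1, hB ω ω' h hω.2⟩

theorem walk_congr {k : ℕ} {ω ω' : ℕ → ℤ × ℤ} (h : ∀ i < k, ω i = ω' i) {j : ℕ} (hj : j ≤ k) :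
    walk j ω = walk j ω' :=
  Finset.sum_congr rfl fun i hi => h i ((Finset.mem_range.1 hi).trans_le hj)

theorem dependsOnFirst_walk_eq {j k : ℕ} (hj : j ≤ k) (v : ℤ × ℤ) :
    DependsOnFirst k {ω | walk j ω = v} :=
  fun _ _ h hω => (walk_congr h hj).symm.trans hω

/-- The first `k` increments. -/
def take (k : ℕ) (ω : ℕ → ℤ × ℤ) : Fin k → ℤ × ℤ := fun i => ω i

theorem DependsOnFirst.exists_preimage_take {k : ℕ} {A : Set (ℕ → ℤ × ℤ)}
    (hA : DependsOnFirst k A) : ∃ A' : Set (Fin k → ℤ × ℤ), take k ⁻¹' A' = A := by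
  refine ⟨take k '' A, Set.Subset.antisymm ?_ (Set.subset_preimage_image _ _)⟩
  rintro ω ⟨ω', hω', h⟩
  exact hA ω' ω (fun i hi => congrFun h ⟨i, hi⟩) hω'

theorem measurable_take (k : ℕ) : Measurable (take k) := by
  unfold take; fun_prop

/-- Such an event is pulled back from the countable discrete space `Fin k → ℤ × ℤ`, where every set
is measurable. -/
theorem DependsOnFirst.measurableSet {k : ℕ} {A : Set (ℕ → ℤ × ℤ)} (hA : DependsOnFirst k A) :
    MeasurableSet A := by
  obtain ⟨A', rfl⟩ := hA.exists_preimage_take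
  exact measurable_take k (Set.to_countable A').measurableSet

theorem indepFun_take_drop (p : unitInterval) (x : Instructions) (k : ℕ) :
    IndepFun (take k) (drop k) (law p x) := by
  have h : iIndepFun (fun (i : ℕ) (ω : ℕ → ℤ × ℤ) => ω i) (law p x) :=
    iIndepFun_infinitePi (X := fun _ ω => ω) (by fun_prop)
  have h2 := indep_iSup_of_disjoint (fun i => (measurable_pi_apply i).comap_le) h.iIndep
    (S := {i | i < k}) (T := {i | k ≤ i})
    (Set.disjoint_left.2 fun i (hi : i < k) (hi' : k ≤ i) => absurd hi (not_lt.2 hi'))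
  rw [IndepFun_iff_Indep]
  refine indep_of_indep_of_le_left (indep_of_indep_of_le_right h2 ?_) ?_
  · rw [MeasurableSpace.pi, MeasurableSpace.comap_iSup]
    refine iSup_le fun i => ?_
    rw [MeasurableSpace.comap_comp]
    exact le_iSup₂_of_le (i + k) (Nat.le_add_left _ _) le_rfl
  · rw [MeasurableSpace.pi, MeasurableSpace.comap_iSup]
    refine iSup_le fun i => ?_
    rw [MeasurableSpace.comap_comp]
    exact le_iSup₂_of_le (i : ℕ) i.2 le_rfl

/-- The Markov property at the deterministic time `k`. -/
theorem setLIntegral_drop (p : unitInterval) (x : Instructions) {k : ℕ} {A : Set (ℕ → ℤ × ℤ)}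
    (hA : DependsOnFirst k A) {F : (ℕ → ℤ × ℤ) → ℝ≥0∞} (hF : Measurable F) :
    ∫⁻ ω in A, F (drop k ω) ∂(law p x) = law p x A * ∫⁻ ω, F ω ∂(law p (x.shift k)) := by
  obtain ⟨A', rfl⟩ := hA.exists_preimage_take
  have hA' : MeasurableSet A' := (Set.to_countable A').measurableSet
  have hind : IndepFun ((A'.indicator 1) ∘ take k) (F ∘ drop k) (law p x) :=
    (indepFun_take_drop p x k).comp (φ := A'.indicator (1 : (Fin k → ℤ × ℤ) → ℝ≥0∞))
      (measurable_one.indicator hA') hF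
  have h := lintegral_mul_eq_lintegral_mul_lintegral_of_indepFun
    ((measurable_one.indicator hA').comp (measurable_take k)) (hF.comp (measurable_drop k)) hind
  rw [← lintegral_indicator hA.measurableSet, ← map_drop_law, lintegral_map hF (measurable_drop k),
    ← lintegral_indicator_one hA.measurableSet]
  refine Eq.trans (lintegral_congr fun ω => ?_) h
  by_cases hω : take k ω ∈ A' <;> simp [Set.indicator, hω]

theorem law_inter_drop (p : unitInterval) (x : Instructions) {k : ℕ} {A B : Set (ℕ → ℤ × ℤ)}
    (hA : DependsOnFirst k A) (hB : MeasurableSet B) :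
    law p x (A ∩ drop k ⁻¹' B) = law p x A * law p (x.shift k) B := by
  have h := setLIntegral_drop p x hA (measurable_one.indicator hB)
  rw [lintegral_indicator_one hB] at h
  rw [← h, Set.inter_comm, ← Measure.restrict_apply (measurable_drop k hB),
    ← lintegral_indicator_one (measurable_drop k hB)]
  rfl

/-! ### Single increments, parity and range of the walk -/

theorem stepLaw_singleton (p : unitInterval) (v u : ℤ × ℤ) :
    stepLaw p v {u} = ENNReal.ofReal (1 - p) * (if v = u then 1 else 0) +
      ∑ e ∈ unitSteps, ENNReal.ofReal (p / 4) * (if e = u then 1 else 0) := by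
  simp [stepLaw, Set.indicator, Measure.coe_finsetSum]

theorem law_step_eq (p : unitInterval) (x : Instructions) (i : ℕ) (u : ℤ × ℤ) :
    law p x {ω | ω i = u} = stepLaw p (x.step i) {u} := by
  rw [← Measure.infinitePi_map_eval (fun t => stepLaw p (x.step t)) i,
    Measure.map_apply (measurable_pi_apply i) (measurableSet_singleton u)]
  rfl

theorem ae_mem_unitSteps (p : unitInterval) (x : Instructions) :
    ∀ᵐ ω ∂(law p x), ∀ i, ω i ∈ unitSteps := by
  rw [ae_all_iff]
  intro i
  have h : ∀ᵐ u ∂(stepLaw p (x.step i)), u ∈ unitSteps := by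
    rw [ae_iff]
    have : ∀ e ∈ unitSteps, (Measure.dirac e) {a : ℤ × ℤ | a ∉ unitSteps} = 0 := by
      intro e he
      simp [he]
    simp only [stepLaw, Measure.coe_add, Measure.coe_smul, Measure.coe_finsetSum, Pi.add_apply,
      Pi.smul_apply, Finset.sum_apply, smul_eq_mul]
    rw [this _ (x.step_mem_unitSteps i), Finset.sum_eq_zero fun e he => by rw [this e he, mul_zero]]
    simp
  rw [← Measure.infinitePi_map_eval (fun t => stepLaw p (x.step t)) i] at h
  exact ae_of_ae_map (measurable_pi_apply i).aemeasurable h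

theorem ae_two_dvd_walk (p : unitInterval) (x : Instructions) (t : ℕ) :
    ∀ᵐ ω ∂(law p x), (2 : ℤ) ∣ (walk t ω).1 + (walk t ω).2 - t := by
  filter_upwards [ae_mem_unitSteps p x] with ω hω
  induction t with
  | zero => simp [walk]
  | succ t ih =>
    have h := hω t
    simp only [unitSteps, Finset.mem_insert, Finset.mem_singleton] at h
    have e : walk (t + 1) ω = walk t ω + ω t := Finset.sum_range_succ _ _
    rw [e]
    rcases h with h | h | h | h <;> rw [h] <;> simp <;> omega

theorem ae_abs_walk_fst_le (p : unitInterval) (x : Instructions) :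
    ∀ᵐ ω ∂(law p x), ∀ t, |(walk t ω).1| ≤ t := by
  filter_upwards [ae_mem_unitSteps p x] with ω hω t
  induction t with
  | zero => simp [walk]
  | succ t ih =>
    have h := hω t
    simp only [unitSteps, Finset.mem_insert, Finset.mem_singleton] at h
    have e : walk (t + 1) ω = walk t ω + ω t := Finset.sum_range_succ _ _
    rw [e]
    rw [abs_le] at ih ⊢
    rcases h with h | h | h | h <;> rw [h] <;> simp <;> omega

/-! ### Fourier inversion on the torus -/

section

open Real

/-- The character `θ ↦ exp (i ⟨w, θ⟩)`. -/
def character (w : ℤ × ℤ) (θ : ℝ × ℝ) : ℂ :=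
  Complex.exp ((w.1 * θ.1 : ℝ) * Complex.I) * Complex.exp ((w.2 * θ.2 : ℝ) * Complex.I)

theorem character_add (v w : ℤ × ℤ) (θ : ℝ × ℝ) :
    character (v + w) θ = character v θ * character w θ := by
  simp only [character, ← Complex.exp_add]
  congr 1
  push_cast [Prod.fst_add, Prod.snd_add]
  ring

theorem norm_character (w : ℤ × ℤ) (θ : ℝ × ℝ) : ‖character w θ‖ = 1 := by
  rw [character, norm_mul, Complex.norm_exp_ofReal_mul_I, Complex.norm_exp_ofReal_mul_I, one_mul]

theorem continuous_character (w : ℤ × ℤ) : Continuous (character w) := by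
  unfold character; fun_prop

/-- A fundamental domain of the torus which contains the points `0` and `(π, π)`, at which the
characteristic functions of the increments have modulus one, in its interior. -/
def box : Set (ℝ × ℝ) := Set.Ioc (-(π / 2)) (3 * π / 2) ×ˢ Set.Ioc (-(π / 2)) (3 * π / 2)

theorem box_subset : box ⊆ Set.Icc (-(π / 2), -(π / 2)) (3 * π / 2, 3 * π / 2) := by
  rintro ⟨a, b⟩ ⟨⟨h1, h2⟩, h3, h4⟩
  exact ⟨⟨h1.le, h3.le⟩, ⟨h2, h4⟩⟩

theorem measurableSet_box : MeasurableSet box := measurableSet_Ioc.prod measurableSet_Ioc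

theorem integrableOn_box {E : Type*} [NormedAddCommGroup E] {f : ℝ × ℝ → E}
    (hf : Continuous f) : IntegrableOn f box :=
  (hf.continuousOn.integrableOn_compact isCompact_Icc).mono_set box_subset

theorem volume_real_box : volume.real box = 4 * π ^ 2 := by
  have h := Real.pi_pos
  rw [box, Measure.real, Measure.volume_eq_prod, Measure.prod_prod, ENNReal.toReal_mul,
    Real.volume_Ioc, ENNReal.toReal_ofReal (by linarith)]
  ring

theorem integral_exp_int_mul_I (k : ℤ) :
    ∫ t in Set.Ioc (-(π / 2)) (3 * π / 2), Complex.exp ((k * t : ℝ) * Complex.I) =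
      if k = 0 then (2 * π : ℂ) else 0 := by
  have h := Real.pi_pos
  rw [← intervalIntegral.integral_of_le (by linarith)]
  split_ifs with hk
  · subst hk
    simp
    ring
  · have hc : (k : ℂ) * Complex.I ≠ 0 := by simp [hk]
    have e : ∀ t : ℝ, Complex.exp ((k * t : ℝ) * Complex.I) =
        Complex.exp ((k : ℂ) * Complex.I * t) := by
      intro t; congr 1; push_cast; ring
    simp only [e]
    rw [integral_exp_mul_complex hc]
    have : (k : ℂ) * Complex.I * ((3 * π / 2 : ℝ) : ℂ) =
        (k : ℂ) * Complex.I * ((-(π / 2) : ℝ) : ℂ) + k * (2 * π * Complex.I) := by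
      push_cast; ring
    rw [this, Complex.exp_add, Complex.exp_int_mul_two_pi_mul_I]
    simp

theorem integral_character (w : ℤ × ℤ) :
    ∫ θ in box, character w θ = if w = 0 then (4 * π ^ 2 : ℂ) else 0 := by
  unfold box character
  rw [Measure.volume_eq_prod,
    setIntegral_prod_mul (fun a : ℝ => Complex.exp ((w.1 * a : ℝ) * Complex.I))
      (fun b : ℝ => Complex.exp ((w.2 * b : ℝ) * Complex.I)), integral_exp_int_mul_I,
    integral_exp_int_mul_I]
  rcases w with ⟨a, b⟩
  by_cases ha : a = 0 <;> by_cases hb : b = 0 <;> simp [ha, hb]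
  ring

/-- The characteristic function of an increment whose instruction is `v`. -/
def stepChar (p : unitInterval) (v : ℤ × ℤ) (θ : ℝ × ℝ) : ℂ :=
  (1 - (p : ℝ) : ℝ) * character v θ + ∑ u ∈ unitSteps, ((p : ℝ) / 4 : ℝ) * character u θ

theorem continuous_stepChar (p : unitInterval) (v : ℤ × ℤ) : Continuous (stepChar p v) := by
  have := continuous_character
  unfold stepChar; fun_prop

theorem stepLaw_real_singleton (p : unitInterval) (v : ℤ × ℤ) {u : ℤ × ℤ} (hu : u ∈ unitSteps) :
    (stepLaw p v).real {u} = (1 - p) * (if v = u then 1 else 0) + p / 4 := by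
  have h0 : (0 : ℝ) ≤ (p : ℝ) / 4 := div_nonneg p.2.1 (by norm_num)
  have h1 : (0 : ℝ) ≤ 1 - (p : ℝ) := sub_nonneg.2 p.2.2
  rw [Measure.real, stepLaw_singleton]
  simp only [mul_ite, mul_one, mul_zero, Finset.sum_ite_eq', hu, if_true]
  rw [ENNReal.toReal_add (by split_ifs <;> simp) (by simp), ENNReal.toReal_ofReal h0]
  split_ifs <;> simp [h1]

theorem law_walk_succ (p : unitInterval) (x : Instructions) (n : ℕ) (w : ℤ × ℤ) :
    (law p x).real {ω | walk (n + 1) ω = w} =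
      (1 - p) * (law p x).real {ω | walk n ω = w - x.step n} +
        ∑ u ∈ unitSteps, (p / 4) * (law p x).real {ω | walk n ω = w - u} := by
  have hm : ∀ u, MeasurableSet ({ω | walk n ω = w - u} ∩ drop n ⁻¹' {ω | ω 0 = u}) := fun u =>
    (measurableSet_walk_eq n _).inter (measurable_drop n
      (measurableSet_eq_fun (measurable_pi_apply 0) measurable_const))
  have e : (law p x).real {ω | walk (n + 1) ω = w} = (law p x).real
      (⋃ u ∈ unitSteps, {ω | walk n ω = w - u} ∩ drop n ⁻¹' {ω | ω 0 = u}) := by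
    refine measureReal_congr (Filter.eventuallyEq_set.2 ?_)
    filter_upwards [ae_mem_unitSteps p x] with ω hω
    have e : walk (n + 1) ω = walk n ω + ω n := Finset.sum_range_succ _ _
    simp only [Set.mem_iUnion, Set.mem_inter_iff, Set.mem_ofPred_eq, Set.mem_preimage, drop,
      zero_add, e]
    constructor
    · intro h
      exact ⟨ω n, hω n, eq_sub_of_add_eq h, rfl⟩
    · rintro ⟨u, -, h, rfl⟩
      rw [h, sub_add_cancel]
  rw [e, measureReal_biUnion_finset]
  · have hs : ∀ u ∈ unitSteps,
        (law p x).real ({ω | walk n ω = w - u} ∩ drop n ⁻¹' {ω | ω 0 = u}) =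
        (1 - p) * (if x.step n = u then (law p x).real {ω | walk n ω = w - u} else 0) +
          p / 4 * (law p x).real {ω | walk n ω = w - u} := by
      intro u hu
      have h := stepLaw_real_singleton p (x.step n) hu
      rw [Measure.real] at h
      rw [Measure.real, law_inter_drop p x (dependsOnFirst_walk_eq le_rfl _)
        (measurableSet_eq_fun (measurable_pi_apply 0) measurable_const), law_step_eq, ENNReal.toReal_mul,
        Instructions.shift_step, zero_add, h, Measure.real]
      split_ifs <;> ring
    rw [Finset.sum_congr rfl hs, Finset.sum_add_distrib, ← Finset.mul_sum, Finset.sum_ite_eq]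
    simp [x.step_mem_unitSteps n]
  · intro u _ v _ huv
    refine Set.disjoint_left.2 fun ω h1 h2 => huv ?_
    exact h1.2.symm.trans h2.2
  · exact fun u _ => hm u

/-- Fourier inversion for the law of the walk at time `n`. -/
theorem law_walk_eq_integral (p : unitInterval) (x : Instructions) (n : ℕ) (w : ℤ × ℤ) :
    (4 * π ^ 2 : ℂ) * ((law p x).real {ω | walk n ω = w} : ℝ) =
      ∫ θ in box, (∏ i ∈ Finset.range n, stepChar p (x.step i) θ) * character (-w) θ := by
  induction n generalizing w with
  | zero =>
    simp only [walk_zero, Finset.range_zero, Finset.prod_empty, one_mul, integral_character,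
      neg_eq_zero, eq_comm (a := (0 : ℤ × ℤ))]
    by_cases h : w = 0 <;> simp [h]
  | succ n ih =>
    have hcont : ∀ u, Continuous fun θ =>
        (∏ i ∈ Finset.range n, stepChar p (x.step i) θ) * character (-(w - u)) θ := fun u =>
      (continuous_finsetProd _ fun i _ => continuous_stepChar p _).mul (continuous_character _)
    have e : ∀ θ, (∏ i ∈ Finset.range (n + 1), stepChar p (x.step i) θ) * character (-w) θ =
        (1 - (p : ℝ) : ℝ) * ((∏ i ∈ Finset.range n, stepChar p (x.step i) θ) *
          character (-(w - x.step n)) θ) +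
        ∑ u ∈ unitSteps, ((p : ℝ) / 4 : ℝ) * ((∏ i ∈ Finset.range n, stepChar p (x.step i) θ) *
          character (-(w - u)) θ) := by
      intro θ
      have hc : ∀ u, character (-(w - u)) θ = character u θ * character (-w) θ := fun u => by
        rw [← character_add]; congr 1; abel
      simp only [hc]
      rw [Finset.prod_range_succ, stepChar, mul_assoc, add_mul, mul_add, Finset.sum_mul,
        Finset.mul_sum]
      congr 1
      · ring
      · exact Finset.sum_congr rfl fun u _ => by ring
    simp only [e]
    rw [integral_add ((integrableOn_box (hcont _)).const_mul _)
        (integrable_finsetSum _ fun u _ => (integrableOn_box (hcont u)).const_mul _),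
      integral_const_mul, integral_finsetSum _
        fun u _ => (integrableOn_box (hcont u)).const_mul _]
    simp only [integral_const_mul]
    rw [← ih, Finset.sum_congr rfl fun u _ => by rw [← ih], law_walk_succ]
    push_cast
    rw [mul_add, Finset.mul_sum]
    congr 1
    · ring
    · exact Finset.sum_congr rfl fun u _ => by ring

/-! ### A bound for point probabilities that is uniform in the instructions -/

/-- The squared modulus of the characteristic function of an increment with horizontal
instruction. -/
def stepCharSq (p : ℝ) (θ : ℝ × ℝ) : ℝ :=
  (1 - p) ^ 2 + p * (1 - p) * cos θ.1 * (cos θ.1 + cos θ.2) +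
    p ^ 2 / 4 * (cos θ.1 + cos θ.2) ^ 2

/-- The modulus of the characteristic function of an increment with horizontal instruction. -/
def stepCharNorm (p : ℝ) (θ : ℝ × ℝ) : ℝ := √(stepCharSq p θ)

theorem continuous_stepCharNorm (p : ℝ) : Continuous (stepCharNorm p) := by
  unfold stepCharNorm stepCharSq; fun_prop

/-- The noise part is real and symmetric. Reversing an instruction therefore conjugates the
characteristic function, and turning it from horizontal to vertical exchanges the coordinates. -/
theorem norm_stepChar (p : unitInterval) {v : ℤ × ℤ} (hv : v ∈ unitSteps) :
    (∀ θ, ‖stepChar p v θ‖ = stepCharNorm p θ) ∨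
      (∀ θ, ‖stepChar p v θ‖ = stepCharNorm p θ.swap) := by
  have hn : unitSteps = {(1, 0), (-1, 0), (0, 1), (0, -1)} := rfl
  have hsum : ∀ θ, stepChar p v θ = (1 - (p : ℝ) : ℝ) * character v θ +
      ((p : ℝ) / 2 * (cos θ.1 + cos θ.2) : ℝ) := by
    intro θ
    rw [stepChar, hn]
    simp [character, Complex.ext_iff, Complex.exp_re, Complex.exp_im,
      -Complex.ofReal_cos]
    ring
  simp only [unitSteps, Finset.mem_insert, Finset.mem_singleton] at hv
  rcases hv with h | h | h | h
  · left; intro θ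
    rw [hsum, stepCharNorm, Complex.norm_def, h]
    congr 1
    simp [character, Complex.normSq_apply, Complex.exp_re, Complex.exp_im, stepCharSq,
      -Complex.ofReal_cos]
    linear_combination (1 - (p : ℝ)) ^ 2 * Real.sin_sq_add_cos_sq θ.1
  · left; intro θ
    rw [hsum, stepCharNorm, Complex.norm_def, h]
    congr 1
    simp [character, Complex.normSq_apply, Complex.exp_re, Complex.exp_im, stepCharSq,
      -Complex.ofReal_cos]
    linear_combination (1 - (p : ℝ)) ^ 2 * Real.sin_sq_add_cos_sq θ.1
  · right; intro θ
    rw [hsum, stepCharNorm, Complex.norm_def, h]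
    congr 1
    simp [character, Complex.normSq_apply, Complex.exp_re, Complex.exp_im, stepCharSq,
      -Complex.ofReal_cos]
    linear_combination (1 - (p : ℝ)) ^ 2 * Real.sin_sq_add_cos_sq θ.2
  · right; intro θ
    rw [hsum, stepCharNorm, Complex.norm_def, h]
    congr 1
    simp [character, Complex.normSq_apply, Complex.exp_re, Complex.exp_im, stepCharSq,
      -Complex.ofReal_cos]
    linear_combination (1 - (p : ℝ)) ^ 2 * Real.sin_sq_add_cos_sq θ.2

theorem integral_box_swap (f : ℝ × ℝ → ℝ) : ∫ θ in box, f θ.swap = ∫ θ in box, f θ := by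
  unfold box
  rw [Measure.volume_eq_prod]
  exact setIntegral_prod_swap _ _ f

/-- AM-GM replaces a product over mixed horizontal and vertical instructions by a mean of pure
`n`-th powers. By the coordinate swap, these all have the same integral over `box`. -/
theorem prod_le_mean_pow {n : ℕ} (hn : n ≠ 0) (z : ℕ → ℝ) (hz : ∀ i, 0 ≤ z i) :
    ∏ i ∈ Finset.range n, z i ≤ ∑ i ∈ Finset.range n, (n : ℝ)⁻¹ * z i ^ n := by
  have h := Real.geom_mean_le_arith_mean_weighted (Finset.range n) (fun _ => (n : ℝ)⁻¹)
    (fun i => z i ^ n) (fun _ _ => by positivity)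
    (by simp [hn]) (fun i _ => pow_nonneg (hz i) n)
  refine le_trans (le_of_eq ?_) h
  exact Finset.prod_congr rfl fun i _ => (Real.pow_rpow_inv_natCast (hz i) hn).symm

/-- A bound, uniform in the instructions, for the point probabilities of the walk. -/
theorem law_walk_le_integral (p : unitInterval) (x : Instructions) {n : ℕ} (hn : n ≠ 0)
    (w : ℤ × ℤ) :
    4 * π ^ 2 * (law p x).real {ω | walk n ω = w} ≤ ∫ θ in box, stepCharNorm p θ ^ n := by
  have hint : ∀ i, Continuous fun θ => ‖stepChar p (x.step i) θ‖ ^ n := fun i =>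
    (continuous_stepChar p _).norm.pow n
  calc 4 * π ^ 2 * (law p x).real {ω | walk n ω = w}
      = ‖(4 * π ^ 2 : ℂ) * ((law p x).real {ω | walk n ω = w} : ℝ)‖ := by
        rw [norm_mul, Complex.norm_real, Real.norm_of_nonneg measureReal_nonneg]
        simp [abs_of_pos Real.pi_pos]
    _ ≤ ∫ θ in box, ‖(∏ i ∈ Finset.range n, stepChar p (x.step i) θ) * character (-w) θ‖ := by
        rw [law_walk_eq_integral]
        exact norm_integral_le_integral_norm _
    _ ≤ ∫ θ in box, ∑ i ∈ Finset.range n, (n : ℝ)⁻¹ * ‖stepChar p (x.step i) θ‖ ^ n := by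
        refine integral_mono (integrableOn_box ?_) (integrableOn_box ?_) fun θ => ?_
        · exact ((continuous_finsetProd _ fun i _ => continuous_stepChar p _).mul
            (continuous_character _)).norm
        · exact continuous_finsetSum _ fun i _ => (hint i).const_mul _
        · simp only [norm_mul, norm_character, mul_one, norm_prod]
          exact prod_le_mean_pow hn _ fun i => norm_nonneg _
    _ = ∑ i ∈ Finset.range n, (n : ℝ)⁻¹ * ∫ θ in box, stepCharNorm p θ ^ n := by
        rw [integral_finsetSum _ fun i _ => (integrableOn_box (hint i)).const_mul _]
        refine Finset.sum_congr rfl fun i _ => ?_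
        rw [integral_const_mul]
        congr 1
        rcases norm_stepChar p (x.step_mem_unitSteps i) with h | h
        · simp only [h]
        · simp only [h]
          exact integral_box_swap fun θ => stepCharNorm p θ ^ n
    _ = ∫ θ in box, stepCharNorm p θ ^ n := by
        rw [Finset.sum_const, Finset.card_range, nsmul_eq_mul, ← mul_assoc,
          mul_inv_cancel₀ (Nat.cast_ne_zero.2 hn), one_mul]

/-! ### Gaussian comparison near the two peaks -/

/-- With `a = 1 - cos θ.1` and `b = 1 - cos θ.2`, the linear part is exactly `p(3 - 2p)a + pb`. The
quadratic remainder is at most `p(a + b)² ≤ εp(a + b)`, which is at most `ε` times the linear part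
because `3 - 2p ≥ 1`. -/
theorem stepCharSq_le {p : ℝ} (hp0 : 0 ≤ p) (hp1 : p ≤ 1) {ε : ℝ} {θ : ℝ × ℝ}
    (h : (1 - cos θ.1) + (1 - cos θ.2) ≤ ε) :
    stepCharSq p θ ≤
      1 - (1 - ε) * (p * (3 - 2 * p) * (1 - cos θ.1) + p * (1 - cos θ.2)) := by
  have ha : 0 ≤ 1 - cos θ.1 := sub_nonneg.2 (cos_le_one _)
  have hb : 0 ≤ 1 - cos θ.2 := sub_nonneg.2 (cos_le_one _)
  have e : stepCharSq p θ = 1 - (p * (3 - 2 * p) * (1 - cos θ.1) + p * (1 - cos θ.2)) +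
      (p * (1 - p) * (1 - cos θ.1) * ((1 - cos θ.1) + (1 - cos θ.2)) +
        p ^ 2 / 4 * ((1 - cos θ.1) + (1 - cos θ.2)) ^ 2) := by
    unfold stepCharSq; ring
  rw [e]
  generalize 1 - cos θ.1 = a at *
  generalize 1 - cos θ.2 = b at *
  have h1 : p * (1 - p) * a * (a + b) + p ^ 2 / 4 * (a + b) ^ 2 ≤ p * (a + b) * (a + b) := by
    have hq : 0 ≤ p * (1 - p) * (b * (a + b)) :=
      mul_nonneg (mul_nonneg hp0 (sub_nonneg.2 hp1)) (mul_nonneg hb (add_nonneg ha hb))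
    nlinarith [sq_nonneg (p * (a + b))]
  have h2 : p * (a + b) * (a + b) ≤ p * (a + b) * ε :=
    mul_le_mul_of_nonneg_left h (mul_nonneg hp0 (add_nonneg ha hb))
  have hε : 0 ≤ ε := (add_nonneg ha hb).trans h
  have h3 : 0 ≤ ε * (p * (1 - p) * a) :=
    mul_nonneg hε (mul_nonneg (mul_nonneg hp0 (sub_nonneg.2 hp1)) ha)
  nlinarith

theorem one_sub_cos_ge {ε x : ℝ} (hε : ε ≤ 1) (hx : |x| ≤ ε) :
    (1 - ε) * (x ^ 2 / 2) ≤ 1 - cos x := by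
  have h := (abs_le.1 (Real.cos_bound (hx.trans hε))).2
  have h0 := abs_nonneg x
  have h4 : |x| ^ 4 ≤ ε * x ^ 2 := by
    rw [← sq_abs x]
    have : |x| * |x| ≤ ε * 1 := mul_le_mul hx (hx.trans hε) h0 (h0.trans hx)
    nlinarith [sq_nonneg (|x|)]
  have h5 : 0 ≤ |x| ^ 4 := by positivity
  nlinarith

/-- The centred Gaussian which approximates the modulus of the characteristic function. -/
def gaussianFactor (κ p : ℝ) (θ : ℝ × ℝ) : ℝ :=
  exp (-(κ / 2 * (p * (3 - 2 * p) / 2)) * θ.1 ^ 2) * exp (-(κ / 2 * (p / 2)) * θ.2 ^ 2)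

theorem stepCharNorm_le_gaussianFactor {p : ℝ} (hp0 : 0 ≤ p) (hp1 : p ≤ 1) {ε : ℝ} (hε : ε ≤ 1)
    {θ : ℝ × ℝ} (h1 : |θ.1| ≤ ε) (h2 : |θ.2| ≤ ε) :
    stepCharNorm p θ ≤ gaussianFactor ((1 - ε) ^ 2) p θ := by
  have hε0 : 0 ≤ ε := (abs_nonneg _).trans h1
  have a1 := one_sub_cos_ge hε h1
  have a2 := one_sub_cos_ge hε h2
  have b1 := Real.one_sub_sq_div_two_le_cos (x := θ.1)
  have b2 := Real.one_sub_sq_div_two_le_cos (x := θ.2)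
  have s1 : θ.1 ^ 2 ≤ ε := by
    rw [← sq_abs]; nlinarith [abs_nonneg θ.1]
  have s2 : θ.2 ^ 2 ≤ ε := by
    rw [← sq_abs]; nlinarith [abs_nonneg θ.2]
  have hS := stepCharSq_le hp0 hp1 (θ := θ) (ε := ε) (by linarith)
  rw [stepCharNorm, gaussianFactor, ← exp_add]
  refine Real.sqrt_le_iff.2 ⟨(exp_pos _).le, hS.trans ?_⟩
  rw [sq, ← exp_add]
  -- One factor `1 - ε` comes from `stepCharSq_le` and one from `one_sub_cos_ge`, whence `κ = (1 -
  -- ε)²`.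
  refine le_trans ?_ (Real.add_one_le_exp _)
  have c1 := mul_le_mul_of_nonneg_left a1
    (mul_nonneg (sub_nonneg.2 hε) (mul_nonneg hp0 (by linarith : (0 : ℝ) ≤ 3 - 2 * p)))
  have c2 := mul_le_mul_of_nonneg_left a2 (mul_nonneg (sub_nonneg.2 hε) hp0)
  nlinarith

/-- Both cosines change sign and enter only through quadratic terms. The second peak at `(π, π)`
reflects the parity of the walk. -/
theorem stepCharNorm_sub_pi (p : ℝ) (θ : ℝ × ℝ) :
    stepCharNorm p (θ - (π, π)) = stepCharNorm p θ := by
  simp only [stepCharNorm, stepCharSq, Prod.fst_sub, Prod.snd_sub, cos_sub_pi]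
  congr 1
  ring

theorem stepCharNorm_lt_one {p : ℝ} (hp0 : 0 < p) (hp1 : p ≤ 1) {θ : ℝ × ℝ}
    (hθ : θ ∈ Set.Icc (-(π / 2), -(π / 2)) (3 * π / 2, 3 * π / 2)) (h0 : θ ≠ 0)
    (hpi : θ ≠ (π, π)) : stepCharNorm p θ < 1 := by
  have hπ := Real.pi_pos
  obtain ⟨⟨l1, l2⟩, u1, u2⟩ := hθ
  have one : ∀ y : ℝ, -(π / 2) ≤ y → y ≤ 3 * π / 2 → cos y = 1 → y = 0 := fun y hy hy' h =>
    (cos_eq_one_iff_of_lt_of_lt (by linarith) (by linarith)).1 h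
  have neg : ∀ y : ℝ, -(π / 2) ≤ y → y ≤ 3 * π / 2 → cos y = -1 → y = π := fun y hy hy' h => by
    have : cos (y - π) = 1 := by rw [cos_sub_pi, h, neg_neg]
    linarith [(cos_eq_one_iff_of_lt_of_lt (by linarith) (by linarith)).1 this]
  have m1 := cos_le_one θ.1
  have m2 := cos_le_one θ.2
  have n1 := neg_one_le_cos θ.1
  have n2 := neg_one_le_cos θ.2
  have hlt : cos θ.1 + cos θ.2 < 2 := by
    by_contra! hc
    exact h0 (Prod.ext (one _ l1 u1 (by linarith)) (one _ l2 u2 (by linarith)))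
  have hgt : -2 < cos θ.1 + cos θ.2 := by
    by_contra! hc
    exact hpi (Prod.ext (neg _ l1 u1 (by linarith)) (neg _ l2 u2 (by linarith)))
  rw [stepCharNorm, Real.sqrt_lt' one_pos, stepCharSq]
  have q1 : (cos θ.1 + cos θ.2) ^ 2 < 4 := by nlinarith
  have q2 : cos θ.1 * (cos θ.1 + cos θ.2) ≤ 2 := by
    nlinarith [sq_nonneg (cos θ.1 - (cos θ.1 + cos θ.2)), sq_nonneg (cos θ.1 - cos θ.2)]
  -- Strictness comes only from the pure noise term, which is where `0 < p` is needed.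
  have r1 := mul_lt_mul_of_pos_left q1 (by positivity : 0 < p ^ 2 / 4)
  have r2 := mul_le_mul_of_nonneg_left q2 (mul_nonneg hp0.le (sub_nonneg.2 hp1))
  nlinarith

/-- Off the balls around the two peaks, the modulus is continuous and less than one on a compact
set; `η` is its maximum there. -/
theorem exists_stepCharNorm_bound {p : ℝ} (hp0 : 0 < p) (hp1 : p ≤ 1) {ε : ℝ} (hε0 : 0 < ε)
    (hε : ε ≤ 1) : ∃ η : ℝ, 0 ≤ η ∧ η < 1 ∧ ∀ θ ∈ box,
      stepCharNorm p θ ≤ gaussianFactor ((1 - ε) ^ 2) p θ ∨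
      stepCharNorm p θ ≤ gaussianFactor ((1 - ε) ^ 2) p (θ - (π, π)) ∨ stepCharNorm p θ ≤ η := by
  set K : Set (ℝ × ℝ) := Set.Icc (-(π / 2), -(π / 2)) (3 * π / 2, 3 * π / 2) \
    (Metric.ball 0 ε ∪ Metric.ball (π, π) ε) with hK
  have hKc : IsCompact K :=
    isCompact_Icc.diff (Metric.isOpen_ball.union Metric.isOpen_ball)
  have hη : ∃ η : ℝ, 0 ≤ η ∧ η < 1 ∧ ∀ θ ∈ K, stepCharNorm p θ ≤ η := by
    rcases K.eq_empty_or_nonempty with h | h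
    · exact ⟨0, le_rfl, one_pos, fun θ hθ => by simp [h] at hθ⟩
    · obtain ⟨θ₀, h₀, hmax⟩ := hKc.exists_isMaxOn h (continuous_stepCharNorm p).continuousOn
      refine ⟨stepCharNorm p θ₀, Real.sqrt_nonneg _, ?_, fun θ hθ => hmax hθ⟩
      refine stepCharNorm_lt_one hp0 hp1 h₀.1 ?_ ?_
      · rintro rfl
        exact h₀.2 (Or.inl (Metric.mem_ball_self hε0))
      · rintro rfl
        exact h₀.2 (Or.inr (Metric.mem_ball_self hε0))
  obtain ⟨η, hη0, hη1, hη⟩ := hη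
  refine ⟨η, hη0, hη1, fun θ hθ => ?_⟩
  have key : ∀ φ : ℝ × ℝ, ‖φ‖ < ε → stepCharNorm p φ ≤ gaussianFactor ((1 - ε) ^ 2) p φ :=
    fun φ hφ => stepCharNorm_le_gaussianFactor hp0.le hp1 hε
      ((norm_fst_le φ).trans hφ.le) ((norm_snd_le φ).trans hφ.le)
  by_cases h0 : θ ∈ Metric.ball (0 : ℝ × ℝ) ε
  · exact Or.inl (key θ (mem_ball_zero_iff.1 h0))
  by_cases h1 : θ ∈ Metric.ball ((π, π) : ℝ × ℝ) ε
  · right; left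
    rw [← stepCharNorm_sub_pi]
    exact key _ (mem_ball_iff_norm.1 h1)
  · exact Or.inr (Or.inr (hη θ ⟨box_subset hθ, fun h => h.elim h0 h1⟩))

theorem gaussianFactor_pow (κ p : ℝ) (θ : ℝ × ℝ) (n : ℕ) :
    gaussianFactor κ p θ ^ n = gaussianFactor (n * κ) p θ := by
  simp only [gaussianFactor, mul_pow, ← exp_nat_mul]
  congr 2 <;> ring

theorem gaussianFactor_pos (κ p : ℝ) (θ : ℝ × ℝ) : 0 < gaussianFactor κ p θ := by
  unfold gaussianFactor; positivity

theorem integrable_gaussianFactor {κ p : ℝ} (hκ : 0 < κ) (hp0 : 0 < p) (hp1 : p ≤ 1) :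
    Integrable (gaussianFactor κ p) := by
  have h3 : 0 < 3 - 2 * p := by linarith
  exact (integrable_exp_neg_mul_sq (by positivity)).mul_prod
    (integrable_exp_neg_mul_sq (by positivity))

theorem integral_gaussianFactor {κ p : ℝ} (hκ : 0 < κ) (hp0 : 0 < p) (hp1 : p ≤ 1) :
    ∫ θ, gaussianFactor κ p θ = 4 * π / (κ * p * √(3 - 2 * p)) := by
  have h3 : 0 < 3 - 2 * p := by linarith
  have hs : 0 < √(3 - 2 * p) := Real.sqrt_pos.2 h3
  have hπ := Real.pi_pos
  unfold gaussianFactor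
  rw [Measure.volume_eq_prod,
    integral_prod_mul (fun a : ℝ => exp (-(κ / 2 * (p * (3 - 2 * p) / 2)) * a ^ 2))
      (fun b : ℝ => exp (-(κ / 2 * (p / 2)) * b ^ 2)), integral_gaussian, integral_gaussian,
    ← Real.sqrt_mul (by positivity)]
  rw [Real.sqrt_eq_iff_mul_self_eq (by positivity) (by positivity)]
  field_simp
  rw [Real.sq_sqrt h3.le]
  ring

/-- Each peak contributes one full Gaussian integral, and the rest of the box is exponentially
small. Up to the factor `(1 - ε)⁻²`, the peaks divided by `4π²` give `heatConst p / n`. -/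
theorem integral_stepCharNorm_pow_le {p : ℝ} (hp0 : 0 < p) (hp1 : p ≤ 1) {ε : ℝ} (hε0 : 0 < ε)
    (hε : ε < 1) : ∃ η : ℝ, 0 ≤ η ∧ η < 1 ∧ ∀ n : ℕ, n ≠ 0 →
      ∫ θ in box, stepCharNorm p θ ^ n ≤
        2 * (4 * π / (n * (1 - ε) ^ 2 * p * √(3 - 2 * p))) + 4 * π ^ 2 * η ^ n := by
  obtain ⟨η, hη0, hη1, h⟩ := exists_stepCharNorm_bound hp0 hp1 hε0 hε.le
  refine ⟨η, hη0, hη1, fun n hn => ?_⟩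
  have hκ : 0 < n * (1 - ε) ^ 2 := by
    have : 0 < 1 - ε := sub_pos.2 hε
    have : (0 : ℝ) < n := by positivity
    positivity
  set g := gaussianFactor (n * (1 - ε) ^ 2) p with hg
  have hgi : Integrable g := integrable_gaussianFactor hκ hp0 hp1
  have hgi' : Integrable fun θ => g (θ - (π, π)) := hgi.comp_sub_right _
  have hg0 : ∀ θ, 0 ≤ g θ := fun θ => (gaussianFactor_pos _ _ θ).le
  have hc : IntegrableOn (fun _ : ℝ × ℝ => η ^ n) box := integrableOn_box continuous_const
  calc ∫ θ in box, stepCharNorm p θ ^ n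
      ≤ ∫ θ in box, (g θ + g (θ - (π, π)) + η ^ n) := by
        refine setIntegral_mono_on (integrableOn_box ((continuous_stepCharNorm p).pow n))
          ((hgi.integrableOn.add hgi'.integrableOn).add hc) measurableSet_box fun θ hθ => ?_
        have hs : 0 ≤ stepCharNorm p θ := Real.sqrt_nonneg _
        have hη : 0 ≤ η ^ n := pow_nonneg hη0 n
        have h0 := hg0 θ
        have h1 := hg0 (θ - (π, π))
        rcases h θ hθ with h | h | h
        · have := pow_le_pow_left₀ hs h n
          rw [gaussianFactor_pow] at this
          linarith
        · have := pow_le_pow_left₀ hs h n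
          rw [gaussianFactor_pow] at this
          linarith
        · have := pow_le_pow_left₀ hs h n
          linarith
    _ = (∫ θ in box, g θ) + (∫ θ in box, g (θ - (π, π))) + 4 * π ^ 2 * η ^ n := by
        rw [integral_add (f := fun θ => g θ + g (θ - (π, π)))
            (hgi.integrableOn.add hgi'.integrableOn) hc,
          integral_add hgi.integrableOn hgi'.integrableOn, setIntegral_const, volume_real_box,
          smul_eq_mul]
    _ ≤ (∫ θ, g θ) + (∫ θ, g (θ - (π, π))) + 4 * π ^ 2 * η ^ n := by
        have h1 : ∫ θ in box, g θ ≤ ∫ θ, g θ :=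
          setIntegral_le_integral hgi (Filter.Eventually.of_forall hg0)
        have h2 : ∫ θ in box, g (θ - (π, π)) ≤ ∫ θ, g (θ - (π, π)) :=
          setIntegral_le_integral hgi' (Filter.Eventually.of_forall fun θ => hg0 _)
        linarith
    _ = _ := by
        rw [integral_sub_right_eq_self, hg, integral_gaussianFactor hκ hp0 hp1]
        ring

/-! ### The uniform local limit estimate -/

/-- The constant of the local limit theorem: the maximal point probability at time `n` is
asymptotically at most `heatConst p / n`. -/
def heatConst (p : ℝ) : ℝ := 2 / (π * p * √(3 - 2 * p))

theorem exists_law_walk_bound (p : unitInterval) (hp : 0 < (p : ℝ)) {D : ℝ}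
    (hD : heatConst p < D) : ∃ N : ℕ, ∀ n ≥ N, ∀ (x : Instructions) (w : ℤ × ℤ),
      n * (law p x).real {ω | walk n ω = w} ≤ D := by
  have hp1 : (p : ℝ) ≤ 1 := p.2.2
  have h3 : 0 < 3 - 2 * (p : ℝ) := by linarith
  have hs : 0 < √(3 - 2 * (p : ℝ)) := Real.sqrt_pos.2 h3
  have hπ := Real.pi_pos
  have hlim : Filter.Tendsto (fun ε : ℝ => heatConst p / (1 - ε) ^ 2) (nhdsWithin 0 (Set.Ioi 0))
      (nhds (heatConst p)) := by
    have : ContinuousAt (fun ε : ℝ => heatConst p / (1 - ε) ^ 2) 0 :=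
      ContinuousAt.div continuousAt_const (by fun_prop) (by norm_num)
    have h := this.tendsto
    simp only [sub_zero, one_pow, div_one] at h
    exact h.mono_left nhdsWithin_le_nhds
  obtain ⟨ε, hεD, hε0, hε1⟩ := ((hlim.eventually (gt_mem_nhds hD)).and
    (Ioo_mem_nhdsGT (one_pos : (0 : ℝ) < 1))).exists
  obtain ⟨η, hη0, hη1, h⟩ := integral_stepCharNorm_pow_le hp hp1 hε0 hε1
  -- The gap left between `heatConst p / (1 - ε)²` and `D` absorbs `n · η ^ n`, which tends to `0`.
  have htail := (tendsto_self_mul_const_pow_of_lt_one hη0 hη1).eventually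
    (gt_mem_nhds (sub_pos.2 hεD))
  obtain ⟨N, hN⟩ := Filter.eventually_atTop.1 htail
  refine ⟨N + 1, fun n hn x w => ?_⟩
  have hn0 : n ≠ 0 := by omega
  have hnp : (0 : ℝ) < n := by positivity
  have hε2 : 0 < 1 - ε := sub_pos.2 hε1
  have h1 := (law_walk_le_integral p x hn0 w).trans (h n hn0)
  have h2 := hN n (by omega)
  have e : 2 * (4 * π / (n * (1 - ε) ^ 2 * p * √(3 - 2 * (p : ℝ)))) =
      4 * π ^ 2 * (heatConst p / (1 - ε) ^ 2 / n) := by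
    unfold heatConst
    field_simp
  rw [e, ← mul_add] at h1
  have h4 := le_of_mul_le_mul_left h1 (by positivity)
  calc n * (law p x).real {ω | walk n ω = w}
      ≤ n * (heatConst p / (1 - ε) ^ 2 / n + η ^ n) := by gcongr
    _ = heatConst p / (1 - ε) ^ 2 + n * η ^ n := by field_simp
    _ ≤ D := by linarith

end

/-! ### First visits and the hitting time -/

/-- The event that `v` is not visited up to time `s`. -/
def avoids (v : ℤ × ℤ) (s : ℕ) : Set (ℕ → ℤ × ℤ) := {ω | ∀ j ≤ s, walk j ω ≠ v}

/-- The event that `v` is visited for the first time at time `r`. -/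
def firstVisit (v : ℤ × ℤ) (r : ℕ) : Set (ℕ → ℤ × ℤ) :=
  {ω | walk r ω = v ∧ ∀ j < r, walk j ω ≠ v}

theorem dependsOnFirst_avoids (v : ℤ × ℤ) (s : ℕ) : DependsOnFirst s (avoids v s) :=
  fun _ _ h hω j hj => (walk_congr h hj) ▸ hω j hj

theorem dependsOnFirst_firstVisit (v : ℤ × ℤ) (r : ℕ) : DependsOnFirst r (firstVisit v r) :=
  fun _ _ h hω => ⟨(walk_congr h le_rfl) ▸ hω.1, fun j hj => (walk_congr h hj.le) ▸ hω.2 j hj⟩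

theorem disjoint_firstVisit (v : ℤ × ℤ) {r s : ℕ} (h : r ≠ s) :
    Disjoint (firstVisit v r) (firstVisit v s) := by
  refine Set.disjoint_left.2 fun ω hr hs => ?_
  rcases lt_or_gt_of_ne h with h | h
  · exact hs.2 r h hr.1
  · exact hr.2 s h hs.1

theorem measurable_hittingTime (v : ℤ × ℤ) : Measurable (hittingTime v) := by
  classical
  unfold hittingTime
  refine Measurable.iInf fun t => ?_
  simp only [iInf_eq_if]
  exact Measurable.ite (measurableSet_walk_eq t v) measurable_const measurable_const

/-- This is one half of the tail-sum formula `T = ∑ 1{T > j}`: only indices below a visit time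
contribute. -/
theorem tsum_avoids_le_hittingTime (v : ℤ × ℤ) (ω : ℕ → ℤ × ℤ) :
    ∑' j, (avoids v j).indicator 1 ω ≤ hittingTime v ω := by
  refine le_iInf₂ fun t ht => ?_
  rw [tsum_eq_sum (s := Finset.range t) fun j hj => ?_]
  · refine (Finset.sum_le_card_nsmul _ _ 1 fun j _ => ?_).trans (by simp)
    exact Set.indicator_le_self' (fun _ _ => zero_le) ω
  · refine Set.indicator_of_notMem (fun h => ?_) _
    exact h t (not_lt.1 fun h' => hj (Finset.mem_range.2 h')) ht

theorem tsum_law_avoids_le (p : unitInterval) (x : Instructions) (v : ℤ × ℤ) :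
    ∑' j, law p x (avoids v j) ≤ expectedHittingTime p x v := by
  have hm : ∀ j, MeasurableSet (avoids v j) := fun j => (dependsOnFirst_avoids v j).measurableSet
  simp only [← fun j => lintegral_indicator_one (μ := law p x) (hm j)]
  rw [← lintegral_tsum fun j => (measurable_one.indicator (hm j)).aemeasurable]
  exact lintegral_mono fun ω => tsum_avoids_le_hittingTime v ω

theorem exists_firstVisit {v : ℤ × ℤ} {ω : ℕ → ℤ × ℤ} (h : hittingTime v ω < ⊤) :
    ∃ r, ω ∈ firstVisit v r := by
  classical
  have : ∃ t, walk t ω = v := by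
    by_contra! hc
    simp [hittingTime, hc] at h
  exact ⟨Nat.find this, Nat.find_spec this, fun j hj => Nat.find_min this hj⟩

/-- Finiteness makes a first visit almost sure; otherwise the sum would miss the paths with `T = ∞`.
-/
theorem expectedHittingTime_le_tsum {p : unitInterval} {x : Instructions} {v : ℤ × ℤ}
    (h : expectedHittingTime p x v < ⊤) :
    expectedHittingTime p x v ≤ ∑' r : ℕ, (r : ℝ≥0∞) * law p x (firstVisit v r) := by
  have hm : ∀ r, MeasurableSet (firstVisit v r) := fun r =>
    (dependsOnFirst_firstVisit v r).measurableSet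
  simp only [← fun r => lintegral_indicator_one (μ := law p x) (hm r),
    ← fun r : ℕ => lintegral_const_mul (μ := law p x) (r : ℝ≥0∞) (measurable_one.indicator (hm r))]
  rw [← lintegral_tsum fun r =>
    ((measurable_one.indicator (hm r)).const_mul (r : ℝ≥0∞)).aemeasurable]
  refine lintegral_mono_ae ?_
  filter_upwards [ae_lt_top (measurable_hittingTime v) h.ne] with ω hω
  obtain ⟨r, hr⟩ := exists_firstVisit hω
  refine le_trans ?_ (ENNReal.le_tsum r)
  rw [Set.indicator_of_mem hr, Pi.one_apply, mul_one]
  exact iInf₂_le r hr.1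

theorem tsum_law_firstVisit_le_one (p : unitInterval) (x : Instructions) (v : ℤ × ℤ) :
    ∑' r, law p x (firstVisit v r) ≤ 1 := by
  rw [← measure_iUnion (fun r s h => disjoint_firstVisit v h) fun r =>
    (dependsOnFirst_firstVisit v r).measurableSet]
  exact prob_le_one

/-- Condition on the position at time `s`: the remaining `m` steps follow shifted instructions and
must make one prescribed displacement, so a bound uniform in the displacement suffices. -/
theorem mul_law_avoids_inter_le (p : unitInterval) (x : Instructions) (v : ℤ × ℤ) {s m : ℕ}
    {c d : ℝ≥0∞} (h : ∀ w, c * law p (x.shift s) {ω | walk m ω = w} ≤ d) :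
    c * law p x (avoids v s ∩ {ω | walk (s + m) ω = v}) ≤ law p x (avoids v s) * d := by
  have hA := dependsOnFirst_avoids v s
  have e : avoids v s = ⋃ z, avoids v s ∩ {ω | walk s ω = z} := by
    ext ω; simp
  have hsub : avoids v s ∩ {ω | walk (s + m) ω = v} ⊆
      ⋃ z, (avoids v s ∩ {ω | walk s ω = z}) ∩ drop s ⁻¹' {ω | walk m ω = v - z} := by
    rintro ω ⟨h1, h2⟩
    refine Set.mem_iUnion.2 ⟨walk s ω, ⟨h1, rfl⟩, ?_⟩
    change walk m (drop s ω) = v - walk s ω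
    have h2 : walk (s + m) ω = v := h2
    rw [← h2, walk_add, add_sub_cancel_left]
  have hz : ∀ z, DependsOnFirst s (avoids v s ∩ {ω | walk s ω = z}) := fun z =>
    hA.inter (dependsOnFirst_walk_eq le_rfl z)
  calc c * law p x (avoids v s ∩ {ω | walk (s + m) ω = v})
      ≤ c * ∑' z, law p x (avoids v s ∩ {ω | walk s ω = z}) *
          law p (x.shift s) {ω | walk m ω = v - z} := by
        gcongr
        refine (measure_mono hsub).trans ((measure_iUnion_le _).trans_eq ?_)
        exact tsum_congr fun z => law_inter_drop p x (hz z) (measurableSet_walk_eq m _)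
    _ = ∑' z, law p x (avoids v s ∩ {ω | walk s ω = z}) *
          (c * law p (x.shift s) {ω | walk m ω = v - z}) := by
        rw [← ENNReal.tsum_mul_left]
        exact tsum_congr fun z => by ring
    _ ≤ ∑' z, law p x (avoids v s ∩ {ω | walk s ω = z}) * d := by
        gcongr with z
        exact h _
    _ = law p x (avoids v s) * d := by
        rw [ENNReal.tsum_mul_right, ← measure_iUnion, ← e]
        · intro a b hab
          refine Set.disjoint_left.2 fun ω h1 h2 => hab ?_
          exact h1.2.symm.trans h2.2
        · exact fun z => (hz z).measurableSet

/-! ### The two estimates of the weighted sum -/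

/-- The paths which visit `v` at time `t` and are there for the first time at time
`r ∈ (t / 2, t]`. -/
def lateFirstVisit (v : ℤ × ℤ) (t r : ℕ) : Set (ℕ → ℤ × ℤ) :=
  {ω | ω ∈ firstVisit v r ∧ t / 2 < r ∧ r ≤ t ∧ walk t ω = v}

theorem measurableSet_lateFirstVisit (v : ℤ × ℤ) (t r : ℕ) :
    MeasurableSet (lateFirstVisit v t r) :=
  (dependsOnFirst_firstVisit v r).measurableSet.inter
    ((MeasurableSet.const _).inter ((MeasurableSet.const _).inter (measurableSet_walk_eq t v)))

theorem tsum_law_lateFirstVisit_le (p : unitInterval) (x : Instructions) (v : ℤ × ℤ) (t : ℕ) :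
    ∑' r, law p x (lateFirstVisit v t r) ≤
      law p x (avoids v (t / 2) ∩ {ω | walk t ω = v}) := by
  rw [← measure_iUnion (fun r s h => (disjoint_firstVisit v h).mono (fun _ hω => hω.1)
    (fun _ hω => hω.1)) (measurableSet_lateFirstVisit v t)]
  refine measure_mono (Set.iUnion_subset fun r ω hω => ⟨fun j hj => ?_, hω.2.2.2⟩)
  exact hω.1.2 j (hj.trans_lt hω.2.1)

theorem law_lateFirstVisit (p : unitInterval) (x : Instructions) (v : ℤ × ℤ) {r m : ℕ}
    (h : m < r) : law p x (lateFirstVisit v (r + m) r) =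
      law p x (firstVisit v r) * law p (x.shift r) {ω | walk m ω = 0} := by
  rw [← law_inter_drop p x (dependsOnFirst_firstVisit v r) (measurableSet_walk_eq m 0)]
  congr 1
  ext ω
  change (ω ∈ firstVisit v r ∧ (r + m) / 2 < r ∧ r ≤ r + m ∧ walk (r + m) ω = v) ↔
    (ω ∈ firstVisit v r ∧ walk m (drop r ω) = 0)
  refine and_congr_right fun hω => ?_
  rw [walk_add, hω.1]
  simp only [add_eq_left]
  exact ⟨fun h => h.2.2, fun h' => ⟨by omega, by omega, h'⟩⟩

/-- Every first visit at a time `r > τ` is followed by at least `R` expected visits during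
`{r, …, r + τ}`. -/
theorem mul_tsum_firstVisit_le (p : unitInterval) (x : Instructions) (v : ℤ × ℤ) (τ : ℕ)
    {R : ℝ≥0∞} (hR : ∀ y, R ≤ ∑ m ∈ Finset.range (τ + 1), law p y {ω | walk m ω = 0}) :
    R * ∑' r : ℕ, (r : ℝ≥0∞) * law p x (firstVisit v r) ≤
      R * τ + ∑' t : ℕ, (t : ℝ≥0∞) * law p x (avoids v (t / 2) ∩ {ω | walk t ω = v}) := by
  have key : ∀ r : ℕ, R * ((r : ℝ≥0∞) * law p x (firstVisit v r)) ≤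
      R * τ * law p x (firstVisit v r) + ∑' t : ℕ, (t : ℝ≥0∞) * law p x (lateFirstVisit v t r) := by
    intro r
    rcases le_or_gt r τ with hr | hr
    · refine le_trans ?_ le_self_add
      -- Early first visits have weight `r ≤ τ`, so in total they cost at most `Rτ`.
      rw [← mul_assoc]
      gcongr
    · refine le_trans ?_ le_add_self
      calc R * ((r : ℝ≥0∞) * law p x (firstVisit v r))
          ≤ (∑ m ∈ Finset.range (τ + 1), law p (x.shift r) {ω | walk m ω = 0}) *
            ((r : ℝ≥0∞) * law p x (firstVisit v r)) := by gcongr; exact hR _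
        _ ≤ ∑ m ∈ Finset.range (τ + 1),
            ((r + m : ℕ) : ℝ≥0∞) * law p x (lateFirstVisit v (r + m) r) := by
          rw [Finset.sum_mul]
          refine Finset.sum_le_sum fun m hm => ?_
          -- Here `m ≤ τ < r`, so `(r + m) / 2 < r`: the first visit is late for every return time
          -- in the window.
          rw [law_lateFirstVisit p x v (by rw [Finset.mem_range] at hm; omega), mul_comm, mul_assoc]
          gcongr
          omega
        _ ≤ ∑' m : ℕ, ((r + m : ℕ) : ℝ≥0∞) * law p x (lateFirstVisit v (r + m) r) :=
          ENNReal.sum_le_tsum _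
        _ ≤ _ := ENNReal.tsum_comp_le_tsum_of_injective (add_right_injective r)
            fun t : ℕ => (t : ℝ≥0∞) * law p x (lateFirstVisit v t r)
  rw [← ENNReal.tsum_mul_left]
  refine (ENNReal.tsum_le_tsum key).trans ?_
  rw [ENNReal.tsum_add, ENNReal.tsum_mul_left, ENNReal.tsum_comm]
  refine add_le_add ?_ (ENNReal.tsum_le_tsum fun t => ?_)
  · exact mul_le_of_le_one_right' (tsum_law_firstVisit_le_one p x v)
  · rw [ENNReal.tsum_mul_left]
    gcongr
    exact tsum_law_lateFirstVisit_le p x v t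

theorem law_walk_eq_zero_of_parity (p : unitInterval) (x : Instructions) {v : ℤ × ℤ} {t : ℕ}
    (h : ¬ (2 : ℤ) ∣ v.1 + v.2 - t) : law p x {ω | walk t ω = v} = 0 := by
  refine measure_mono_null (fun ω (hω : walk t ω = v) => ?_) (ae_iff.1 (ae_two_dvd_walk p x t))
  change ¬ (2 : ℤ) ∣ (walk t ω).1 + (walk t ω).2 - t
  rwa [hω]

/-- The times `2j` and `2j + 1` share the event `avoids v j`, and only the one with the parity of
`v` contributes. Without parity the leading constant would be `4 * D`. -/
theorem tsum_avoids_inter_le (p : unitInterval) (x : Instructions) (v : ℤ × ℤ) {N : ℕ}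
    {D : ℝ≥0∞} (hN : ∀ n ≥ N, ∀ (y : Instructions) (w : ℤ × ℤ),
      (n : ℝ≥0∞) * law p y {ω | walk n ω = w} ≤ D) :
    ∑' t : ℕ, (t : ℝ≥0∞) * law p x (avoids v (t / 2) ∩ {ω | walk t ω = v}) ≤
      2 * D * ∑' j, law p x (avoids v j) + ∑ j ∈ Finset.range N, (2 * j + 1 : ℝ≥0∞) := by
  set F : ℕ → ℝ≥0∞ := fun t => (t : ℝ≥0∞) * law p x (avoids v (t / 2) ∩ {ω | walk t ω = v})
    with hF
  -- For `j < N` the local bound is not available; the trivial bound `t ≤ 2j + 1` covers both times.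
  set d : ℕ → ℝ≥0∞ := fun j => if j < N then 2 * j + 1 else 0 with hd
  have heven : ∀ j, F (2 * j) ≤ law p x (avoids v j) * (2 * D + d j) := by
    intro j
    simp only [hF, show 2 * j / 2 = j by omega]
    rw [two_mul]
    refine mul_law_avoids_inter_le p x v fun w => ?_
    rcases lt_or_ge j N with hj | hj
    · refine (mul_le_of_le_one_right' prob_le_one).trans (le_trans ?_ le_add_self)
      simp only [hd, hj, if_true]
      push_cast
      rw [two_mul]
      exact le_self_add
    · refine le_trans ?_ le_self_add
      push_cast
      rw [← two_mul, mul_assoc]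
      gcongr
      exact hN j hj _ w
  have hodd : ∀ j, F (2 * j + 1) ≤ law p x (avoids v j) * (2 * D + d j) := by
    intro j
    simp only [hF, show (2 * j + 1) / 2 = j by omega]
    rw [show 2 * j + 1 = j + (j + 1) by ring]
    refine mul_law_avoids_inter_le p x v fun w => ?_
    rcases lt_or_ge j N with hj | hj
    · refine (mul_le_of_le_one_right' prob_le_one).trans (le_trans ?_ le_add_self)
      simp only [hd, hj, if_true]
      push_cast
      rw [two_mul, add_assoc]
    · refine le_trans ?_ le_self_add
      -- For odd times `j + 1` steps remain, and `2j + 1 ≤ 2(j + 1)` keeps the constant `2 * D`.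
      have h1 : ((j + (j + 1) : ℕ) : ℝ≥0∞) ≤ 2 * ((j + 1 : ℕ) : ℝ≥0∞) := by
        exact_mod_cast (by omega : j + (j + 1) ≤ 2 * (j + 1))
      refine (mul_le_mul_left h1 _).trans ?_
      rw [mul_assoc]
      gcongr
      exact hN (j + 1) (by omega) _ w
  have hzero : ∀ t, ¬ (2 : ℤ) ∣ v.1 + v.2 - (t : ℕ) → F t = 0 := fun t ht => by
    simp only [hF]
    rw [measure_mono_null Set.inter_subset_right (law_walk_eq_zero_of_parity p x ht), mul_zero]
  have hpair : ∀ j, F (2 * j) + F (2 * j + 1) ≤ law p x (avoids v j) * (2 * D + d j) := by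
    intro j
    by_cases h : (2 : ℤ) ∣ v.1 + v.2
    · rw [hzero (2 * j + 1) (by push_cast; omega), add_zero]
      exact heven j
    · rw [hzero (2 * j) (by push_cast; omega), zero_add]
      exact hodd j
  rw [← tsum_even_add_odd ENNReal.summable ENNReal.summable, ← ENNReal.tsum_add]
  refine (ENNReal.tsum_le_tsum hpair).trans ?_
  simp only [mul_add]
  rw [ENNReal.tsum_add, ENNReal.tsum_mul_right, mul_comm]
  gcongr
  calc ∑' j, law p x (avoids v j) * d j ≤ ∑' j, d j :=
        ENNReal.tsum_le_tsum fun j => mul_le_of_le_one_left' prob_le_one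
    _ = ∑ j ∈ Finset.range N, (2 * j + 1 : ℝ≥0∞) := by
        rw [tsum_eq_sum (s := Finset.range N) fun j hj => by
          simp only [hd, if_neg (fun h => hj (Finset.mem_range.2 h))]]
        exact Finset.sum_congr rfl fun j hj => if_pos (Finset.mem_range.1 hj)

theorem mul_expectedHittingTime_le {p : unitInterval} {x : Instructions} {v : ℤ × ℤ}
    (h : expectedHittingTime p x v < ⊤) (τ : ℕ) {R : ℝ≥0∞}
    (hR : ∀ y, R ≤ ∑ m ∈ Finset.range (τ + 1), law p y {ω | walk m ω = 0}) {N : ℕ}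
    {D : ℝ≥0∞} (hN : ∀ n ≥ N, ∀ (y : Instructions) (w : ℤ × ℤ),
      (n : ℝ≥0∞) * law p y {ω | walk n ω = w} ≤ D) :
    R * expectedHittingTime p x v ≤ R * τ + (2 * D * expectedHittingTime p x v +
      ∑ j ∈ Finset.range N, (2 * j + 1 : ℝ≥0∞)) := by
  calc R * expectedHittingTime p x v
      ≤ R * ∑' r : ℕ, (r : ℝ≥0∞) * law p x (firstVisit v r) := by
        gcongr; exact expectedHittingTime_le_tsum h
    _ ≤ _ := mul_tsum_firstVisit_le p x v τ hR
    _ ≤ _ := by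
        gcongr
        refine (tsum_avoids_inter_le p x v hN).trans ?_
        gcongr
        exact tsum_law_avoids_le p x v

/-! ### Arbitrarily large finite expected hitting times -/

theorem law_constant_steps_ne_zero {p : unitInterval} (hp : 0 < (p : ℝ)) (x : Instructions)
    {u : ℤ × ℤ} (hu : u ∈ unitSteps) (k : ℕ) : law p x {ω | ∀ i < k, ω i = u} ≠ 0 := by
  have e : {ω : ℕ → ℤ × ℤ | ∀ i < k, ω i = u} = Set.pi (Finset.range k) fun _ => {u} := by
    ext ω; simp [Set.mem_pi]
  rw [e, law, Measure.infinitePi_pi _ fun i _ => measurableSet_singleton u]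
  refine Finset.prod_ne_zero_iff.2 fun i _ h => ?_
  have h1 : (stepLaw p (x.step i)).real {u} = 0 := by rw [Measure.real, h]; rfl
  rw [stepLaw_real_singleton p _ hu] at h1
  have h2 : (0 : ℝ) ≤ (1 - p) * (if x.step i = u then 1 else 0) :=
    mul_nonneg (sub_nonneg.2 p.2.2) (by split_ifs <;> norm_num)
  linarith

theorem exists_far_home {p : unitInterval} (hp : 0 < (p : ℝ)) {home : ℤ × ℤ} (hhome : home ≠ 0)
    {x : Instructions} (hfin : expectedHittingTime p x home < ⊤) (k : ℕ) :
    ∃ (y : Instructions) (v : ℤ × ℤ), expectedHittingTime p y v < ⊤ ∧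
      (k : ℝ≥0∞) ≤ expectedHittingTime p y v := by
  -- The horizontal direction `σ` leads away from home, so the straight path never meets home and
  -- after `n` steps is at horizontal distance at least `n`.
  obtain ⟨σ, hσ, hne, hfar⟩ : ∃ σ : ℤ, (σ, (0 : ℤ)) ∈ unitSteps ∧
      (∀ n : ℕ, ((n * σ, 0) : ℤ × ℤ) ≠ home) ∧ ∀ n : ℕ, (n : ℤ) ≤ |home.1 - n * σ| := by
    rcases lt_or_ge 0 home.1 with h | h
    · refine ⟨-1, by decide, fun n hn => ?_, fun n => ?_⟩
      · rw [← hn] at h; simp at h; omega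
      · rw [le_abs]; left; omega
    · refine ⟨1, by decide, fun n hn => ?_, fun n => ?_⟩
      · rw [← hn] at h
        apply hhome
        have : (n : ℤ) = 0 := by simp at h; omega
        rw [← hn, this]; rfl
      · rw [le_abs]; right; omega
  have hwalk : ∀ ω : ℕ → ℤ × ℤ, (∀ i < k, ω i = (σ, 0)) → ∀ j ≤ k, walk j ω = (j * σ, 0) := by
    intro ω hω j hj
    rw [walk, Finset.sum_congr rfl fun i hi => hω i ((Finset.mem_range.1 hi).trans_le hj)]
    simp
  refine ⟨x.shift k, home - (k * σ, 0), ?_, ?_⟩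
  · set A : Set (ℕ → ℤ × ℤ) := {ω | ∀ i < k, ω i = (σ, 0)} with hA
    have hdep : DependsOnFirst k A := fun ω ω' h hω i hi => (h i hi).symm.trans (hω i hi)
    have h0 : law p x A ≠ 0 := law_constant_steps_ne_zero hp x hσ k
    -- The Markov property gives `P(A) · E[T'] ≤ E[T] < ∞` for the remaining hitting time `T'`;
    -- since `P(A) > 0`, `E[T']` is finite.
    have h1 := setLIntegral_drop p x hdep (measurable_hittingTime (home - (k * σ, 0)))
    have h2 : ∫⁻ ω in A, hittingTime (home - (k * σ, 0)) (drop k ω) ∂(law p x) ≤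
        expectedHittingTime p x home := by
      refine (setLIntegral_mono (measurable_hittingTime home) fun ω hω => ?_).trans
        (setLIntegral_le_lintegral _ _)
      refine le_iInf₂ fun t ht => ?_
      have hkt : k ≤ t := by
        by_contra! hlt
        rw [hwalk ω hω t hlt.le] at ht
        exact hne t ht
      obtain ⟨m, rfl⟩ := Nat.exists_eq_add_of_le hkt
      refine (iInf₂_le m ?_).trans (by exact_mod_cast Nat.le_add_left m k)
      rw [walk_add, hwalk ω hω k le_rfl] at ht
      rw [← ht, add_sub_cancel_left]
    rw [h1] at h2
    exact ENNReal.lt_top_of_mul_ne_top_right (h2.trans_lt hfin).ne h0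
  · have h : ∀ᵐ ω ∂(law p (x.shift k)), (k : ℝ≥0∞) ≤ hittingTime (home - (k * σ, 0)) ω := by
      filter_upwards [ae_abs_walk_fst_le p (x.shift k)] with ω hω
      refine le_iInf₂ fun t ht => ?_
      have h1 := hω t
      rw [ht] at h1
      have h2 : (k : ℤ) ≤ t := (hfar k).trans h1
      exact_mod_cast h2
    calc (k : ℝ≥0∞) = ∫⁻ _, (k : ℝ≥0∞) ∂(law p (x.shift k)) := by simp
      _ ≤ _ := lintegral_mono_ae h

/-! ### Expected visits and the conclusion -/

theorem integral_visits (p : unitInterval) (x : Instructions) (τ : ℕ) :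
    ∫ ω, (visits τ ω : ℝ) ∂(law p x) =
      ∑ m ∈ Finset.range (τ + 1), (law p x).real {ω | walk m ω = 0} := by
  have e : ∀ ω, (visits τ ω : ℝ) = ∑ m ∈ Finset.range (τ + 1),
      ({ω | walk m ω = 0} : Set (ℕ → ℤ × ℤ)).indicator 1 ω := by
    intro ω
    rw [visits, Finset.card_filter]
    push_cast
    refine Finset.sum_congr rfl fun m _ => ?_
    simp [Set.indicator]
  simp only [e]
  rw [integral_finsetSum _ fun m _ => (integrable_const 1).indicator (measurableSet_walk_eq m 0)]
  exact Finset.sum_congr rfl fun m _ => integral_indicator_one (measurableSet_walk_eq m 0)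

theorem minReturns_le (p : unitInterval) (x : Instructions) (τ : ℕ) :
    minReturns τ p ≤ ∑ m ∈ Finset.range (τ + 1), (law p x).real {ω | walk m ω = 0} := by
  rw [← integral_visits]
  refine ciInf_le ⟨0, ?_⟩ x
  rintro _ ⟨y, rfl⟩
  exact integral_nonneg fun ω => Nat.cast_nonneg _

theorem one_le_minReturns (p : unitInterval) (x : Instructions) (τ : ℕ) :
    1 ≤ minReturns τ p := by
  have : Nonempty Instructions := ⟨x⟩
  refine le_ciInf fun y => ?_
  rw [integral_visits]
  have h0 : (law p y).real {ω | walk 0 ω = 0} = 1 := by simp [walk_zero]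
  rw [← h0]
  exact Finset.single_le_sum (f := fun m => (law p y).real {ω | walk m ω = 0})
    (fun m _ => measureReal_nonneg) (Finset.mem_range.2 (Nat.succ_pos τ))

theorem minReturns_le_two_mul_heatConst {p : unitInterval} (hp : 0 < (p : ℝ)) {home : ℤ × ℤ}
    (hhome : home ≠ 0) {x : Instructions} (hfin : expectedHittingTime p x home < ⊤) (τ : ℕ) :
    minReturns τ p ≤ 2 * heatConst p := by
  by_contra! hlt
  set R := minReturns τ p with hRdef
  obtain ⟨D, hD, hDR⟩ := exists_between (by linarith : heatConst p < R / 2)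
  obtain ⟨N, hN⟩ := exists_law_walk_bound p hp hD
  have hR0 : 0 ≤ R := zero_le_one.trans (one_le_minReturns p x τ)
  have hD0 : 0 ≤ D := le_trans (by positivity) (hN N le_rfl x 0)
  have hR : ∀ y, ENNReal.ofReal R ≤
      ∑ m ∈ Finset.range (τ + 1), law p y {ω | walk m ω = 0} := by
    intro y
    refine ENNReal.ofReal_le_of_le_toReal ?_
    rw [ENNReal.toReal_sum fun m _ => measure_ne_top _ _]
    exact minReturns_le p y τ
  have hN' : ∀ n ≥ N, ∀ (y : Instructions) (w : ℤ × ℤ),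
      (n : ℝ≥0∞) * law p y {ω | walk n ω = w} ≤ ENNReal.ofReal D := by
    intro n hn y w
    rw [ENNReal.le_ofReal_iff_toReal_le (by finiteness) hD0, ENNReal.toReal_mul]
    exact hN n hn y w
  -- `B` involves neither the instructions nor the target; this uniformity lets large hitting times
  -- give the contradiction.
  set B : ℝ := R * τ + ∑ j ∈ Finset.range N, (2 * j + 1 : ℝ) with hB
  have hbound : ∀ (y : Instructions) (v : ℤ × ℤ), expectedHittingTime p y v < ⊤ →
      (R - 2 * D) * (expectedHittingTime p y v).toReal ≤ B := by
    intro y v hy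
    have h := mul_expectedHittingTime_le hy τ hR hN'
    have hS : ∑ j ∈ Finset.range N, (2 * j + 1 : ℝ≥0∞) ≠ ⊤ :=
      ENNReal.sum_ne_top.2 fun j _ => by finiteness
    have hE := hy.ne
    have h' := ENNReal.toReal_mono (by finiteness) h
    rw [ENNReal.toReal_add (by finiteness) (by finiteness),
      ENNReal.toReal_add (by finiteness) hS,
      ENNReal.toReal_sum fun j _ => by finiteness] at h'
    simp only [ENNReal.toReal_mul, ENNReal.toReal_ofReal hR0, ENNReal.toReal_ofReal hD0,
      ENNReal.toReal_natCast, ENNReal.toReal_ofNat] at h'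
    have hj : ∀ j : ℕ, (2 * j + 1 : ℝ≥0∞).toReal = 2 * j + 1 := fun j => by
      rw [ENNReal.toReal_add (by finiteness) (by finiteness)]
      simp
    simp only [hj] at h'
    rw [hB]
    linarith
  obtain ⟨k, hk⟩ := exists_nat_gt (B / (R - 2 * D))
  obtain ⟨y, v, hy, hky⟩ := exists_far_home hp hhome hfin k
  have h1 := hbound y v hy
  have h2 : (k : ℝ) ≤ (expectedHittingTime p y v).toReal := by
    simpa using ENNReal.toReal_mono hy.ne hky
  have h3 : 0 < R - 2 * D := by linarith
  rw [div_lt_iff₀ h3] at hk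
  nlinarith

end GuidedWalk

end

theorem mainTheorem4 (p : unitInterval) (hp : 0 < (p : ℝ)) (home : ℤ × ℤ) (hhome : home ≠ 0)
    (hfin : ∃ x : GuidedWalk.Instructions, GuidedWalk.expectedHittingTime p x home < ⊤)
    (τ : ℕ) (hτ : 0 < τ) :
    1 ≤ 4 / (Real.pi * (p : ℝ) * Real.sqrt (3 - 2 * (p : ℝ)) * GuidedWalk.minReturns τ p) := by
  obtain ⟨x, hx⟩ := hfin
  have h := GuidedWalk.minReturns_le_two_mul_heatConst hp hhome hx τ
  have h1 := GuidedWalk.one_le_minReturns p x τ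
  have hp1 : (p : ℝ) ≤ 1 := p.2.2
  have hs : 0 < Real.sqrt (3 - 2 * (p : ℝ)) := Real.sqrt_pos.2 (by linarith)
  have hπ := Real.pi_pos
  have hc : 0 < Real.pi * (p : ℝ) * Real.sqrt (3 - 2 * (p : ℝ)) := by positivity
  rw [one_le_div (by positivity)]
  rw [GuidedWalk.heatConst, ← mul_div_assoc, le_div_iff₀ hc] at h
  linarith
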